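/- Let $\mathcal C$ be a triangulated category with a weight structure $w$, in the homological convention. That is, $w$ is a pair of classes of objects $\mathcal C_{w\le 0},\mathcal C_{w\ge 0}$, each closed under retracts, such that $\mathcal C_{w\le 0}\subset \mathcal C_{w\le 0}[1]$ and $\mathcal C_{w\ge 0}[1]\subset\mathcal C_{w\ge 0}$; there are no nonzero morphisms from $\mathcal C_{w\le 0}$ to $\mathcal C_{w\ge 0}[1]$; and every object $M$ fits into a distinguished triangle $X\to M\to Y\to X[1]$ with $X\in\mathcal C_{w\le 0}$ and $Y\in\mathcal C_{w\ge 0}[1]$. Boundedness of $w$ is not assumed. Put $\mathcal C_{w\le i}=\mathcal C_{w\le 0}[i]$, $\mathcal C_{w\ge i}=\mathcal C_{w\ge 0}[i]$ and $\mathcal C_{[i,j]}=\mathcal C_{w\ge i}\cap\mathcal C_{w\le j}$. The heart $\underline{Hw}$ of $w$ is the full subcategory of $\mathcal C$ on the objects of $\mathcal C_{w\ge 0}\cap\mathcal C_{w\le 0}$. For a class $B$ of objects of $\mathcal C$ let $\langle B\rangle$ denote the smallest strictly full triangulated subcategory of $\mathcal C$ containing $B$ (it need not be closed under retracts). For such a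 subcategory $\mathcal D=\langle B\rangle$ let $L:\mathcal C\to\mathcal C/\mathcal D$ be the Verdier localization. An exact functor is weight-exact if it respects both the classes $w\le 0$ and the classes $w\ge 0$. A class $S$ of morphisms of a category $\mathcal A$ satisfies the right Ore condition if for any $s:c\to d$ in $S$ and any morphism $f:b\to d$ of $\mathcal A$ there are an object $a$, a morphism $g:a\to b$ that belongs to $S$, and a morphism $t:a\to c$ with $f\circ g=s\circ t$. The left Ore condition is the dual one. No cancellation property is required. (1) Suppose that $\mathcal D=\langle B\rangle$ for a class $B$ of objects of $\underline{Hw}$. Then there is a unique weight structure $w_{\mathcal C/\mathcal D}$ on $\mathcal C/\mathcal D$ for which $L$ is weight-exact, and any object of its heart is isomorphic to $L(X)$ for some object $X$ of $\underline{Hw}$. (2) Suppose that $\mathcal D=\langle \mathrm{Cone}(S)\rangle$, where $S$ is a class of morphisms of $\underline{Hw}$ that satisfies both the left and the right Ore conditions in $\underline{Hw}$, and $\mathrm{Cone}(S)$ is the class of all cones of elements of $S$. Then there is a unique weight structure $w_{\mathcal C/\mathcal D}$ on $\mathcal C/\mathcal D$ for which $L$ is weight-exact, and any object of its heart is isomorphic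 to $L(X)$ for some $X\in\mathcal C_{[-1,0]}$. -/

import Mathlib

open CategoryTheory CategoryTheory.Limits CategoryTheory.Pretriangulated

universe v u v' u'

section Definitions

variable {C : Type u} [Category.{v} C] [HasZeroObject C] [HasShift C ℤ] [Preadditive C]
  [∀ n : ℤ, (shiftFunctor C n).Additive] [Pretriangulated C]
  {D : Type u'} [Category.{v'} D] [HasZeroObject D] [HasShift D ℤ] [Preadditive D]
  [∀ n : ℤ, (shiftFunctor D n).Additive] [Pretriangulated D]

variable (C) in
/-- A weight structure on a triangulated category (homological convention):
`leZero` and `geZero` are the classes `C_{w ≤ 0}` and `C_{w ≥ 0}`. -/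
@[ext]
structure WeightStructure where
  leZero : ObjectProperty C
  geZero : ObjectProperty C
  /-- The classes contain all retracts of their elements. -/
  leZero_retract : leZero.IsStableUnderRetracts
  geZero_retract : geZero.IsStableUnderRetracts
  /-- Semi-invariance: `C_{w ≤ 0} ⊆ C_{w ≤ 0}[1]` and `C_{w ≥ 0}[1] ⊆ C_{w ≥ 0}`. -/
  leZero_shift : ∀ X : C, leZero X → leZero (X⟦(-1 : ℤ)⟧)
  geZero_shift : ∀ X : C, geZero X → geZero (X⟦(1 : ℤ)⟧)
  /-- Orthogonality: there are no nonzero morphisms from `C_{w ≤ 0}` to `C_{w ≥ 0}[1]`. -/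
  orthogonal : ∀ (X Y : C), leZero X → geZero Y → ∀ f : X ⟶ Y⟦(1 : ℤ)⟧, f = 0
  /-- Weight decompositions. -/
  exists_decomposition : ∀ M : C, ∃ (X Y : C) (f : X ⟶ M) (g : M ⟶ Y⟦(1 : ℤ)⟧)
    (h : Y⟦(1 : ℤ)⟧ ⟶ X⟦(1 : ℤ)⟧),
    leZero X ∧ geZero Y ∧ Triangle.mk f g h ∈ distTriang C

namespace WeightStructure

/-- `C_{w ≤ i} = C_{w ≤ 0}[i]`. -/
def le (w : WeightStructure C) (i : ℤ) : ObjectProperty C := fun X => w.leZero (X⟦-i⟧)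

/-- `C_{w ≥ i} = C_{w ≥ 0}[i]`. -/
def ge (w : WeightStructure C) (i : ℤ) : ObjectProperty C := fun X => w.geZero (X⟦-i⟧)

/-- `C_{[i,j]} = C_{w ≥ i} ∩ C_{w ≤ j}`. -/
def between (w : WeightStructure C) (i j : ℤ) : ObjectProperty C := w.ge i ⊓ w.le j

/-- The class `C_{w = 0}` of objects of the heart; the heart itself is the full
subcategory `w.heart.FullSubcategory`. -/
def heart (w : WeightStructure C) : ObjectProperty C := w.geZero ⊓ w.leZero

/-- Weight-exactness of an exact functor `F`. -/
def IsWeightExact (w : WeightStructure C) (w' : WeightStructure D) (F : C ⥤ D)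
    [F.CommShift ℤ] [F.IsTriangulated] : Prop :=
  (∀ X : C, w.leZero X → w'.leZero (F.obj X)) ∧ (∀ X : C, w.geZero X → w'.geZero (F.obj X))

/-- `w'` is the weight structure induced by `w` along `F`: the unique one for which
`F` is weight-exact. -/
def IsInduced (w : WeightStructure C) (w' : WeightStructure D) (F : C ⥤ D)
    [F.CommShift ℤ] [F.IsTriangulated] : Prop :=
  w.IsWeightExact w' F ∧ ∀ w'' : WeightStructure D, w.IsWeightExact w'' F → w'' = w'

end WeightStructure

/-- The (objects of the) smallest strictly full triangulated subcategory containing `G`.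
It need not be closed under retracts. -/
def triangulatedSubcategoryGeneratedBy (G : ObjectProperty C) : ObjectProperty C :=
  fun X => ∀ P : ObjectProperty C, P.IsTriangulated → P.IsClosedUnderIsomorphisms → G ≤ P → P X

instance (G : ObjectProperty C) :
    (triangulatedSubcategoryGeneratedBy G).IsClosedUnderIsomorphisms where
  of_iso e hX P hP hP' hG := P.prop_of_iso e (hX P hP hP' hG)

instance (G : ObjectProperty C) : (triangulatedSubcategoryGeneratedBy G).IsTriangulated where
  exists_zero := by
    obtain ⟨Z, hZ⟩ := HasZeroObject.zero (C := C)
    exact ⟨Z, hZ, fun P _ _ _ => P.prop_of_isZero hZ⟩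
  isStableUnderShiftBy n := ⟨fun _ hX P hP hP' hG => P.le_shift n _ (hX P hP hP' hG)⟩
  ext₂' T hT h₁ h₃ := ObjectProperty.le_isoClosure _ _ (fun P hP hP' hG =>
    P.ext_of_isTriangulatedClosed₂ T hT (h₁ P hP hP' hG) (h₃ P hP hP' hG))

/-- The Verdier quotient `C / T` by the triangulated subcategory `T`: the localization of `C` at
the morphisms whose cone belongs to `T`, with its triangulated structure from Mathlib. -/
abbrev VerdierQuotient [IsTriangulated C] (T : ObjectProperty C) [T.IsTriangulated] :=
  T.trW.Localization

/-- The localization functor `C ⥤ C / T`. -/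
noncomputable abbrev verdierFunctor [IsTriangulated C] (T : ObjectProperty C) [T.IsTriangulated] :
    C ⥤ VerdierQuotient T :=
  T.trW.Q

/-- All cones of the morphisms in a class `S` of morphisms of the heart. -/
def conesOfHeartMorphisms (w : WeightStructure C) (S : MorphismProperty w.heart.FullSubcategory) :
    ObjectProperty C :=
  fun Z => ∃ (X Y : w.heart.FullSubcategory) (s : X ⟶ Y), S s ∧
    ∃ (g : Y.obj ⟶ Z) (h : Z ⟶ X.obj⟦(1 : ℤ)⟧),
      Triangle.mk (w.heart.ι.map s) g h ∈ distTriang C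

end Definitions

section Ore

variable {A : Type u} [Category.{v} A]

/-- The right Ore condition: every pair `s : c ⟶ d` in `S`, `f : b ⟶ d` can be completed to a
commutative square whose side `g : a ⟶ b` opposite to `s` lies in `S` (no cancellation property
is required). -/
def RightOreCondition (S : MorphismProperty A) : Prop :=
  ∀ ⦃b c d : A⦄ (s : c ⟶ d) (f : b ⟶ d), S s →
    ∃ (a : A) (g : a ⟶ b) (t : a ⟶ c), S g ∧ g ≫ f = t ≫ s

/-- The left Ore condition, dual to `RightOreCondition`. -/
def LeftOreCondition (S : MorphismProperty A) : Prop :=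
  ∀ ⦃b c d : A⦄ (s : d ⟶ c) (f : d ⟶ b), S s →
    ∃ (a : A) (g : b ⟶ a) (t : c ⟶ a), S g ∧ f ≫ g = s ≫ t

end Ore

/-! Write `D` for the subcategory being killed. The only candidate for the induced structure is the
pair of retract-closures of the images of the two classes (`exists_isInduced`). Everything but
orthogonality is formal, and uniqueness holds because comparable weight structures coincide.

Orthogonality: a morphism `L X ⟶ L Y` with `X` of weight `≤ 0` and `Y` of weight `≥ 1` is a roof
whose denominator has cone `N` in `D`. It vanishes if the map `X ⟶ N` is killed by some `q : X' ⟶ X`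
inverted by `L`, with `X'` still of weight `≤ 0`. This property of `N` (`Approximable`) passes to
extensions, so it is checked on shifts of generators. Weight `≥ 1` is trivial, and for weight `≤ 0`
the fibre works. Only a cone of a morphism of `S`, of weights `0` and `1`, needs more: the right Ore
condition (`approximable_cone`).

Heart: an object `M` whose image lies in the heart is replaced by a bounded one
(`exists_bounded_of_retract`), and then its extreme weights are removed one at a time. Above, a
splitting in the quotient is realised in `C` by the left Ore condition (`exists_le_zero`). Below,
`exists_ge_zero` may create weight `1`, so the process stops at weights `-1` and `0`. When the
generators lie in the heart, `L` is full on the heart and the morphisms it kills factor through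
killed heart objects. This removes the weight `-1` as well (`exists_heart_of_between`). -/

section WeightBasics

variable {C : Type u} [Category.{v} C] [HasZeroObject C] [HasShift C ℤ] [Preadditive C]
  [∀ n : ℤ, (shiftFunctor C n).Additive] [Pretriangulated C]

/-! ### Distinguished triangles. -/

section Triangles

variable {X Y Z : C} {f : X ⟶ Y} {g : Y ⟶ Z} {h : Z ⟶ X⟦(1 : ℤ)⟧}

lemma distTriang_of_iso (hT : Triangle.mk f g h ∈ distTriang C)
    {X' Y' Z' : C} {f' : X' ⟶ Y'} {g' : Y' ⟶ Z'} {h' : Z' ⟶ X'⟦(1 : ℤ)⟧}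
    (a : X' ≅ X) (b : Y' ≅ Y) (c : Z' ≅ Z) (hab : f' ≫ b.hom = a.hom ≫ f)
    (hbc : g' ≫ c.hom = b.hom ≫ g) (hca : h' ≫ a.hom⟦(1 : ℤ)⟧' = c.hom ≫ h) :
    Triangle.mk f' g' h' ∈ distTriang C :=
  isomorphic_distinguished _ hT _ (Triangle.isoMk _ _ a b c hab hbc hca)

/-- A distinguished triangle may be replaced by one with an isomorphic middle object. -/
lemma distTriang_of_iso₂ {M : C} (hT : Triangle.mk f g h ∈ distTriang C) (e : Y ≅ M) :
    Triangle.mk (f ≫ e.hom) (e.inv ≫ g) h ∈ distTriang C :=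
  distTriang_of_iso hT (Iso.refl _) e.symm (Iso.refl _) (by simp) (by simp) (by simp)

/-- A triangle whose third object is a shift comes from a morphism into its first object. -/
lemma exists_distTriang_of_shift {M : C} {f : X ⟶ M} {g : M ⟶ Y⟦(1 : ℤ)⟧}
    {h : Y⟦(1 : ℤ)⟧ ⟶ X⟦(1 : ℤ)⟧} (hT : Triangle.mk f g h ∈ distTriang C) :
    ∃ u : Y ⟶ X, Triangle.mk u f g ∈ distTriang C := by
  -- The sign compensates for the one introduced by rotation.
  obtain ⟨u, hu⟩ := (shiftFunctor C (1 : ℤ)).map_surjective (-h)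
  have hT' : Triangle.mk f g (-(shiftFunctor C (1 : ℤ)).map u) ∈ distTriang C := by
    rwa [hu, neg_neg]
  exact ⟨u, (rotate_distinguished_triangle _).2 hT'⟩

variable (hT : Triangle.mk f g h ∈ distTriang C)
include hT

lemma distTriang_exists_lift {W : C} (φ : W ⟶ Y) (hφ : φ ≫ g = 0) : ∃ ψ : W ⟶ X, φ = ψ ≫ f :=
  Triangle.coyoneda_exact₂ _ hT φ hφ

lemma distTriang_exists_lift₃ {W : C} (φ : W ⟶ Z) (hφ : φ ≫ h = 0) : ∃ ψ : W ⟶ Y, φ = ψ ≫ g :=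
  Triangle.coyoneda_exact₃ _ hT φ hφ

lemma distTriang_exists_desc {W : C} (φ : Y ⟶ W) (hφ : f ≫ φ = 0) : ∃ ψ : Z ⟶ W, φ = g ≫ ψ :=
  Triangle.yoneda_exact₂ _ hT φ hφ

lemma distTriang_comp_eq_zero : f ≫ g = 0 :=
  comp_distTriang_mor_zero₁₂ _ hT

lemma rotate_distTriang : Triangle.mk g h (-f⟦(1 : ℤ)⟧') ∈ distTriang C :=
  rot_of_distTriang _ hT

lemma exists_invRotate_distTriang :
    ∃ (a : Z⟦(-1 : ℤ)⟧ ⟶ X) (b : Y ⟶ Z⟦(-1 : ℤ)⟧⟦(1 : ℤ)⟧), Triangle.mk a f b ∈ distTriang C :=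
  ⟨_, _, inv_rot_of_distTriang _ hT⟩

end Triangles

/-! ### Weights: shifts, orthogonality, extensions. -/

namespace WeightStructure

variable (w : WeightStructure C)

instance : w.leZero.IsStableUnderRetracts := w.leZero_retract

instance : w.geZero.IsStableUnderRetracts := w.geZero_retract

instance (n : ℤ) : (w.le n).IsStableUnderRetracts :=
  ⟨fun h hY => w.leZero.prop_of_retract (h.map (shiftFunctor C (-n))) hY⟩

instance (n : ℤ) : (w.ge n).IsStableUnderRetracts :=
  ⟨fun h hY => w.geZero.prop_of_retract (h.map (shiftFunctor C (-n))) hY⟩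

lemma le_shift_iff {a n m : ℤ} (h : n + a = m) (X : C) : w.le m (X⟦a⟧) ↔ w.le n X :=
  w.leZero.prop_iff_of_iso ((shiftFunctorAdd' C a (-m) (-n) (by lia)).symm.app X)

lemma ge_shift_iff {a n m : ℤ} (h : n + a = m) (X : C) : w.ge m (X⟦a⟧) ↔ w.ge n X :=
  w.geZero.prop_iff_of_iso ((shiftFunctorAdd' C a (-m) (-n) (by lia)).symm.app X)

lemma le_zero_iff (X : C) : w.le 0 X ↔ w.leZero X :=
  w.leZero.prop_iff_of_iso ((shiftFunctorZero' C (-(0 : ℤ)) (by simp)).app X)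

lemma ge_zero_iff (X : C) : w.ge 0 X ↔ w.geZero X :=
  w.geZero.prop_iff_of_iso ((shiftFunctorZero' C (-(0 : ℤ)) (by simp)).app X)

lemma heart_iff (X : C) : w.heart X ↔ w.ge 0 X ∧ w.le 0 X := by
  rw [le_zero_iff, ge_zero_iff]; rfl

lemma le_succ {n : ℤ} {X : C} (h : w.le n X) : w.le (n + 1) X :=
  w.leZero.prop_of_iso ((shiftFunctorAdd' C (-n) (-1) (-(n + 1)) (by lia)).symm.app X)
    (w.leZero_shift _ h)

lemma ge_succ {n : ℤ} {X : C} (h : w.ge (n + 1) X) : w.ge n X :=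
  w.geZero.prop_of_iso ((shiftFunctorAdd' C (-(n + 1)) 1 (-n) (by lia)).symm.app X)
    (w.geZero_shift _ h)

lemma le_mono {n m : ℤ} (h : n ≤ m) {X : C} (hX : w.le n X) : w.le m X := by
  induction m, h using Int.leInduction with
  | base => exact hX
  | succ k _ ih => exact w.le_succ ih

lemma ge_anti {n m : ℤ} (h : n ≤ m) {X : C} (hX : w.ge m X) : w.ge n X := by
  induction m, h using Int.leInduction with
  | base => exact hX
  | succ k _ ih => exact ih (w.ge_succ hX)

lemma orth {n m : ℤ} (h : n < m) {X Y : C} (hX : w.le n X) (hY : w.ge m Y) (f : X ⟶ Y) :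
    f = 0 := by
  have hY' : w.ge 0 (Y⟦-n⟧⟦(-1 : ℤ)⟧) := by
    rw [w.ge_shift_iff (n := 1) (by lia), w.ge_shift_iff (n := n + 1) (by lia)]
    exact w.ge_anti (by lia) hY
  rw [ge_zero_iff] at hY'
  apply (shiftFunctor C (-n)).map_injective
  rw [Functor.map_zero, ← cancel_mono ((shiftEquiv C (1 : ℤ)).counitIso.inv.app _), zero_comp]
  exact w.orthogonal _ _ hX hY' _

lemma exists_decomposition_le (n m : ℤ) (hm : n + 1 = m) (M : C) :
    ∃ (X Y : C) (f : X ⟶ M) (g : M ⟶ Y) (h : Y ⟶ X⟦(1 : ℤ)⟧),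
      w.le n X ∧ w.ge m Y ∧ Triangle.mk f g h ∈ distTriang C := by
  obtain ⟨X, Y, f, g, h, hX, hY, hT⟩ := w.exists_decomposition (M⟦-n⟧)
  have hT' := distTriang_of_iso₂ (Triangle.shift_distinguished _ hT n)
    ((shiftFunctorCompIsoId C (-n) n (by lia)).app M)
  refine ⟨_, _, _, _, _, ?_, ?_, hT'⟩
  · exact (w.le_shift_iff (n := 0) (by lia) X).2 ((w.le_zero_iff X).2 hX)
  · refine (w.ge_shift_iff (n := 1) (by lia) _).2 ((w.ge_shift_iff (n := 0) (by lia) Y).2 ?_)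
    exact (w.ge_zero_iff Y).2 hY

/-- The map to the upper part of a weight decomposition vanishes, so `X` is a retract of the lower
part. -/
lemma le_of_orth {n m : ℤ} (hm : n + 1 = m) {X : C}
    (hX : ∀ (Y : C), w.ge m Y → ∀ f : X ⟶ Y, f = 0) : w.le n X := by
  obtain ⟨A, B, f, g, h, hA, hB, hT⟩ := w.exists_decomposition_le n m hm X
  obtain ⟨i, hi⟩ := distTriang_exists_lift hT (𝟙 X) (by simp [hX B hB g])
  exact (w.le n).prop_of_retract ⟨i, f, hi.symm⟩ hA

lemma ge_of_orth {n m : ℤ} (hm : n + 1 = m) {Y : C}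
    (hY : ∀ (X : C), w.le n X → ∀ f : X ⟶ Y, f = 0) : w.ge m Y := by
  obtain ⟨A, B, f, g, h, hA, hB, hT⟩ := w.exists_decomposition_le n m hm Y
  obtain ⟨i, hi⟩ := distTriang_exists_desc hT (𝟙 Y) (by simp [hY A hA f])
  exact (w.ge m).prop_of_retract ⟨g, i, hi.symm⟩ hB

section Triangles

variable {X Y Z : C} {f : X ⟶ Y} {g : Y ⟶ Z} {h : Z ⟶ X⟦(1 : ℤ)⟧}
  (hT : Triangle.mk f g h ∈ distTriang C)
include hT

lemma le_obj₂ {n : ℤ} (hX : w.le n X) (hZ : w.le n Z) : w.le n Y := by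
  refine w.le_of_orth rfl fun W hW φ => ?_
  obtain ⟨ψ, rfl⟩ := distTriang_exists_desc hT φ (w.orth (by lia) hX hW _)
  rw [show ψ = 0 from w.orth (by lia) hZ hW _, comp_zero]

lemma ge_obj₂ {n : ℤ} (hX : w.ge n X) (hZ : w.ge n Z) : w.ge n Y := by
  refine w.ge_of_orth (n := n - 1) (by lia) fun W hW φ => ?_
  obtain ⟨ψ, rfl⟩ := distTriang_exists_lift hT φ (w.orth (by lia) hW hZ _)
  rw [show ψ = 0 from w.orth (by lia) hW hX _, zero_comp]

lemma le_obj₁ {n m : ℤ} (hm : n + 1 = m) (hY : w.le n Y) (hZ : w.le m Z) : w.le n X :=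
  w.le_obj₂ (inv_rot_of_distTriang _ hT) ((w.le_shift_iff (by lia) Z).2 hZ) hY

lemma ge_obj₁ {n m : ℤ} (hm : n + 1 = m) (hY : w.ge n Y) (hZ : w.ge m Z) : w.ge n X :=
  w.ge_obj₂ (inv_rot_of_distTriang _ hT) ((w.ge_shift_iff (by lia) Z).2 hZ) hY

lemma le_obj₃ {n m : ℤ} (hm : n + 1 = m) (hX : w.le n X) (hY : w.le m Y) : w.le m Z :=
  w.le_obj₂ (rot_of_distTriang _ hT) hY ((w.le_shift_iff hm X).2 hX)

lemma ge_obj₃ {n m : ℤ} (hm : n + 1 = m) (hX : w.ge n X) (hY : w.ge m Y) : w.ge m Z :=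
  w.ge_obj₂ (rot_of_distTriang _ hT) hY ((w.ge_shift_iff hm X).2 hX)

end Triangles

/-- Two weight structures that are comparable are equal. -/
lemma eq_of_le {w w' : WeightStructure C} (hle : w.leZero ≤ w'.leZero)
    (hge : w.geZero ≤ w'.geZero) : w' = w := by
  have hle' : ∀ n, w.le n ≤ w'.le n := fun n X hX => hle _ hX
  have hge' : ∀ n, w.ge n ≤ w'.ge n := fun n X hX => hge _ hX
  ext X
  · refine ⟨fun hX => ?_, fun hX => hle _ hX⟩
    rw [← le_zero_iff] at hX ⊢
    exact w.le_of_orth rfl fun Y hY f => w'.orth (by lia) hX (hge' _ _ hY) f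
  · refine ⟨fun hX => ?_, fun hX => hge _ hX⟩
    rw [← ge_zero_iff] at hX ⊢
    exact w.ge_of_orth (n := -1) rfl fun Y hY f => w'.orth (by lia) (hle' _ _ hY) hX f

lemma heart_of_iso {X Y : C} (e : X ≅ Y) (hX : w.heart X) : w.heart Y :=
  ⟨w.geZero.prop_of_iso e hX.1, w.leZero.prop_of_iso e hX.2⟩

end WeightStructure

end WeightBasics

/-- The composition of the inclusion of the fibre of `v` with the projection to the cone of `u`
is an isomorphism when `u ≫ v` is. -/
lemma isIso_fibre_to_cone {C : Type u} [Category.{v} C] [HasZeroObject C] [HasShift C ℤ]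
    [Preadditive C] [∀ n : ℤ, (shiftFunctor C n).Additive] [Pretriangulated C]
    {X₁ X₂ X₃ Z F : C} {u : X₁ ⟶ X₂} {y : X₂ ⟶ Z} {a : Z ⟶ X₁⟦(1 : ℤ)⟧}
    (hu : Triangle.mk u y a ∈ distTriang C) {z : F ⟶ X₂} {v : X₂ ⟶ X₃} {c : X₃ ⟶ F⟦(1 : ℤ)⟧}
    (hv : Triangle.mk z v c ∈ distTriang C) [IsIso (u ≫ v)] : IsIso (z ≫ y) := by
  -- Monomorphisms and epimorphisms split in a triangulated category, so it suffices to check that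
  -- `z ≫ y` is both.
  have : Mono u := mono_of_mono u v
  have : Epi v := epi_of_epi u v
  have hz : Mono z := Triangle.mono₁ _ hv (Triangle.mor₃_eq_zero_of_epi₂ _ hv ‹Epi v›)
  have hy : Epi y := Triangle.epi₂ _ hu (Triangle.mor₃_eq_zero_of_mono₁ _ hu ‹Mono u›)
  have hzv := distTriang_comp_eq_zero hv
  have huy := distTriang_comp_eq_zero hu
  have hm : Mono (z ≫ y) := by
    refine Preadditive.mono_of_cancel_zero _ fun f hf => ?_
    obtain ⟨k, hk⟩ := distTriang_exists_lift hu (f ≫ z) (by simpa using hf)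
    have : k = 0 := by
      rw [← cancel_mono (u ≫ v), ← Category.assoc, ← hk, Category.assoc, hzv]; simp
    rw [← cancel_mono z, hk, this]; simp
  have he : Epi (z ≫ y) := by
    refine Preadditive.epi_of_cancel_zero _ fun f hf => ?_
    obtain ⟨k, hk⟩ := distTriang_exists_desc hv (y ≫ f) (by simpa using hf)
    have : k = 0 := by
      rw [← cancel_epi (u ≫ v), Category.assoc, ← hk, reassoc_of% huy]; simp
    rw [← cancel_epi y, hk, this]; simp
  have := isSplitMono_of_mono (z ≫ y)
  exact isIso_of_epi_of_isSplitMono _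

/-! ### Exact functors and localizations. -/

section Quotient

set_option linter.unusedSectionVars false

open Category ZeroObject

variable {C : Type u} [Category.{v} C] [HasZeroObject C] [HasShift C ℤ] [Preadditive C]
  [∀ n : ℤ, (shiftFunctor C n).Additive] [Pretriangulated C]
  {E : Type u'} [Category.{v'} E] [HasZeroObject E] [HasShift E ℤ] [Preadditive E]
  [∀ n : ℤ, (shiftFunctor E n).Additive] [Pretriangulated E]

section

variable (L : C ⥤ E) [L.CommShift ℤ] [L.IsTriangulated]

lemma map_distTriang {X Y Z : C} {f : X ⟶ Y} {g : Y ⟶ Z} {h : Z ⟶ X⟦(1 : ℤ)⟧}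
    (hT : Triangle.mk f g h ∈ distTriang C) :
    Triangle.mk (L.map f) (L.map g) (L.map h ≫ (L.commShiftIso (1 : ℤ)).hom.app X) ∈
      distTriang E :=
  L.map_distinguished _ hT

lemma isIso_map_fibre_to_cone {X₁ X₂ X₃ Z F : C} {u : X₁ ⟶ X₂} {y : X₂ ⟶ Z}
    {a : Z ⟶ X₁⟦(1 : ℤ)⟧} (hu : Triangle.mk u y a ∈ distTriang C) {z : F ⟶ X₂} {v : X₂ ⟶ X₃}
    {c : X₃ ⟶ F⟦(1 : ℤ)⟧} (hv : Triangle.mk z v c ∈ distTriang C)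
    (huv : IsIso (L.map u ≫ L.map v)) : IsIso (L.map (z ≫ y)) := by
  rw [L.map_comp]
  exact isIso_fibre_to_cone (map_distTriang L hu) (map_distTriang L hv)

lemma isIso_map_of_isZero {X Y Z : C} {f : X ⟶ Y} {g : Y ⟶ Z} {h : Z ⟶ X⟦(1 : ℤ)⟧}
    (hT : Triangle.mk f g h ∈ distTriang C) (hZ : IsZero (L.obj Z)) : IsIso (L.map f) :=
  (Triangle.isZero₃_iff_isIso₁ _ (map_distTriang L hT)).1 hZ

lemma exists_section_map {X Y Z : C} {f : X ⟶ Y} {g : Y ⟶ Z} {h : Z ⟶ X⟦(1 : ℤ)⟧}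
    (hT : Triangle.mk f g h ∈ distTriang C) (hf : L.map f = 0) :
    ∃ σ, σ ≫ L.map h = 𝟙 (L.obj (X⟦(1 : ℤ)⟧)) := by
  have hepi : Epi (L.map h ≫ (L.commShiftIso (1 : ℤ)).hom.app X) :=
    Triangle.epi₃ _ (map_distTriang L hT) hf
  have := isSplitEpi_of_epi (L.map h ≫ (L.commShiftIso (1 : ℤ)).hom.app X)
  have hσ := IsSplitEpi.id (L.map h ≫ (L.commShiftIso (1 : ℤ)).hom.app X)
  refine ⟨(L.commShiftIso (1 : ℤ)).hom.app X ≫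
    section_ (L.map h ≫ (L.commShiftIso (1 : ℤ)).hom.app X), ?_⟩
  rw [← cancel_mono ((L.commShiftIso (1 : ℤ)).hom.app X), assoc, assoc, hσ, comp_id, id_comp]

variable {L} in
lemma nonempty_iso_of_shift {M M' : C} {a b : ℤ} (h : a + b = 0)
    (e : Nonempty (L.obj M' ≅ L.obj (M⟦a⟧))) : Nonempty (L.obj (M'⟦b⟧) ≅ L.obj M) :=
  ⟨(L.commShiftIso b).app M' ≪≫ (shiftFunctor E b).mapIso e.some ≪≫
    ((L.commShiftIso b).app (M⟦a⟧)).symm ≪≫ L.mapIso ((shiftFunctorCompIsoId C a b h).app M)⟩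

lemma isZero_obj_of_localization (D : ObjectProperty C) [L.IsLocalization D.trW] {N : C}
    (hN : D N) : IsZero (L.obj N) := by
  have : IsIso (L.map (0 : (0 : C) ⟶ N)) :=
    Localization.inverts L D.trW _ ⟨_, _, _, contractible_distinguished₁ N, hN⟩
  exact (L.map_isZero (isZero_zero C)).of_iso (asIso (L.map (0 : (0 : C) ⟶ N))).symm

end

/-! ### Parts of weight zero and approximability. -/

namespace WeightStructure

variable (w : WeightStructure C)

lemma le_of_isZero (n : ℤ) {X : C} (hX : IsZero X) : w.le n X :=
  w.le_of_orth rfl fun _ _ _ => hX.eq_of_src _ _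

lemma ge_of_isZero (n : ℤ) {X : C} (hX : IsZero X) : w.ge n X :=
  w.ge_of_orth (n := n - 1) (by lia) fun _ _ _ => hX.eq_of_tgt _ _

/-- `p : X ⟶ H` exhibits `H` as the part of weight zero of the object `X` of weight `≤ 0`. -/
def IsHeartQuotient {X H : C} (p : X ⟶ H) : Prop :=
  w.heart H ∧ ∃ (F : C) (a : H ⟶ F) (b : F ⟶ X⟦(1 : ℤ)⟧),
    w.le 0 F ∧ Triangle.mk p a b ∈ distTriang C

lemma exists_isHeartQuotient {X : C} (hX : w.le 0 X) :
    ∃ (H : C) (p : X ⟶ H), w.IsHeartQuotient p := by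
  obtain ⟨A, B, f, g, h, hA, hB, hT⟩ := w.exists_decomposition_le (-1) 0 (by lia) X
  exact ⟨B, g, (w.heart_iff B).2 ⟨hB, w.le_obj₃ hT (by lia) hA hX⟩, _, _, _,
    (w.le_shift_iff (by lia) A).2 hA, rotate_distTriang hT⟩

lemma isHeartQuotient_of_isIso {H H' : C} (hH : w.heart H) (p : H' ⟶ H) [IsIso p] :
    w.IsHeartQuotient p :=
  ⟨hH, 0, 0, 0, w.le_of_isZero 0 (isZero_zero C),
    distTriang_of_iso (contractible_distinguished H) (asIso p) (Iso.refl _) (Iso.refl _)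
      (by simp) (by simp) (by simp)⟩

variable {w} in
-- The fibre of `p` is `F⟦-1⟧`, of weight `≤ -1`, hence orthogonal to `Y`.
lemma IsHeartQuotient.exists_desc {X H Y : C} {p : X ⟶ H} (hp : w.IsHeartQuotient p)
    (hY : w.ge 0 Y) (g : X ⟶ Y) : ∃ g' : H ⟶ Y, g = p ≫ g' := by
  obtain ⟨_, F, a, b, hF, hT⟩ := hp
  obtain ⟨a', b', hT'⟩ := exists_invRotate_distTriang hT
  exact distTriang_exists_desc hT' g
    (w.orth (n := -1) (by lia) ((w.le_shift_iff (n := 0) (by lia) F).2 hF) hY _)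

variable {w} in
-- By the octahedral axiom the cone of `q ≫ p` is an extension of the cone of `p` by `N`.
lemma IsHeartQuotient.comp [IsTriangulated C] {X X' H N : C} {p : X ⟶ H}
    (hp : w.IsHeartQuotient p) {q : X' ⟶ X} {a : X ⟶ N} {b : N ⟶ X'⟦(1 : ℤ)⟧}
    (hq : Triangle.mk q a b ∈ distTriang C) (hN : w.le 0 N) : w.IsHeartQuotient (q ≫ p) := by
  obtain ⟨hH, F, c, d, hF, hT⟩ := hp
  obtain ⟨F', c', d', hT'⟩ := distinguished_cocone_triangle (q ≫ p)
  exact ⟨hH, F', c', d', w.le_obj₂ (Triangulated.someOctahedron rfl hq hT hT').mem hN hF, hT'⟩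

variable {w} in
lemma IsHeartQuotient.le_zero {X H : C} {p : X ⟶ H} (hp : w.IsHeartQuotient p) : w.le 0 X := by
  obtain ⟨hH, F, a, b, hF, hT⟩ := hp
  exact w.le_obj₁ hT rfl ((w.heart_iff H).1 hH).2 (w.le_mono (by lia) hF)

/-- Morphisms from objects of weight `≤ 0` to `N` are killed by morphisms that are, together with
the induced morphism on parts of weight zero, elements of `K`. -/
def Approximable (K : MorphismProperty (Arrow C)) : ObjectProperty C :=
  fun N => ∀ ⦃p : Arrow C⦄, w.IsHeartQuotient p.hom → ∀ f : p.left ⟶ N,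
    ∃ (p' : Arrow C) (φ : p' ⟶ p), w.IsHeartQuotient p'.hom ∧ K φ ∧ φ.left ≫ f = 0

section

variable (K : MorphismProperty (Arrow C)) [K.IsMultiplicative]

instance : (w.Approximable K).IsClosedUnderIsomorphisms where
  of_iso e h p hp f := by
    obtain ⟨p', φ, hp', hφ, hf⟩ := h hp (f ≫ e.inv)
    exact ⟨p', φ, hp', hφ, by simpa using hf =≫ e.hom⟩

instance : (w.Approximable K).IsTriangulatedClosed₂ := by
  refine .mk' fun T hT h₁ h₃ p hp f => ?_
  -- Kill the component in the third object, lift to the first, and kill the lift.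
  obtain ⟨p', φ, hp', hφ, hf⟩ := h₃ hp (f ≫ T.mor₂)
  obtain ⟨g, hg⟩ := Triangle.coyoneda_exact₂ _ hT (φ.left ≫ f) (by simpa using hf)
  obtain ⟨p'', φ', hp'', hφ', hf'⟩ := h₁ hp' g
  exact ⟨p'', φ' ≫ φ, hp'', K.comp_mem _ _ hφ' hφ, by
    rw [Arrow.comp_left, assoc, hg, reassoc_of% hf', zero_comp]⟩

lemma approximable_of_ge {N : C} (hN : w.ge 1 N) : w.Approximable K N := fun p hp f =>
  ⟨p, 𝟙 p, hp, K.id_mem p, by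
    rw [Arrow.id_left, id_comp]; exact w.orth (by lia) hp.le_zero hN f⟩

lemma approximable_of_generators (G : ObjectProperty C)
    (hG : ∀ (n : ℤ) (Z : C), G Z → w.Approximable K (Z⟦n⟧)) :
    triangulatedSubcategoryGeneratedBy G ≤ w.Approximable K := by
  -- Approximability need not be shift-stable, so it is imposed on all shifts at once.
  let P : ObjectProperty C := fun N => ∀ n : ℤ, w.Approximable K (N⟦n⟧)
  have hP : P.IsClosedUnderIsomorphisms :=
    ⟨fun e h n => (w.Approximable K).prop_of_iso ((shiftFunctor C n).mapIso e) (h n)⟩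
  have : P.IsTriangulated :=
    { exists_zero := ⟨0, isZero_zero C, fun n => w.approximable_of_ge K
        (w.ge_of_isZero 1 ((shiftFunctor C n).map_isZero (isZero_zero C)))⟩
      isStableUnderShiftBy := fun a => ⟨fun N h n => (w.Approximable K).prop_of_iso
        ((shiftFunctorAdd' C a n (a + n) rfl).app N) (h (a + n))⟩
      ext₂' := fun T hT h₁ h₃ => ObjectProperty.le_isoClosure _ _ fun n =>
        (w.Approximable K).ext_of_isTriangulatedClosed₂ _ (Triangle.shift_distinguished T hT n)
          (h₁ n) (h₃ n) }
  intro N hN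
  exact (w.Approximable K).prop_of_iso ((shiftFunctorZero C ℤ).app N)
    (hN P this hP (fun Z hZ n => hG n Z hZ) 0)

end

/-- The morphisms of arrows whose source components become invertible under `L` and whose target
components belong to `T`. -/
def invertedLeft (L : C ⥤ E) (T : MorphismProperty C) : MorphismProperty (Arrow C) :=
  fun _ _ φ => IsIso (L.map φ.left) ∧ T φ.right

instance (L : C ⥤ E) (T : MorphismProperty C) [T.IsMultiplicative] :
    (invertedLeft L T).IsMultiplicative where
  id_mem p := ⟨by rw [Arrow.id_left]; infer_instance, T.id_mem _⟩
  comp_mem φ ψ := fun ⟨_, h⟩ ⟨_, h'⟩ =>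
    ⟨by rw [Arrow.comp_left, L.map_comp]; infer_instance, T.comp_mem _ _ h h'⟩

/-- A morphism to an object of weight `≤ 0` killed by `L` is killed by the inclusion of its
fibre. -/
lemma exists_fibre_of_le [IsTriangulated C] (L : C ⥤ E) [L.CommShift ℤ]
    [L.IsTriangulated] (T : MorphismProperty C) [T.ContainsIdentities] {p : Arrow C}
    (hp : w.IsHeartQuotient p.hom) {N : C} (hN : w.le 0 N) (hN' : IsZero (L.obj N))
    (f : p.left ⟶ N) :
    ∃ (p' : Arrow C) (φ : p' ⟶ p) (b : N ⟶ p'.left⟦(1 : ℤ)⟧), w.IsHeartQuotient p'.hom ∧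
      invertedLeft L T φ ∧ Triangle.mk φ.left f b ∈ distTriang C := by
  obtain ⟨X', q, b, hT⟩ := distinguished_cocone_triangle₁ f
  exact ⟨Arrow.mk (q ≫ p.hom), Arrow.homMk q (𝟙 _) (by simp), b, hp.comp hT hN,
    ⟨isIso_map_of_isZero L hT hN', T.id_mem _⟩, hT⟩

lemma isBounded_generated (G : ObjectProperty C)
    (hG : ∀ Z, G Z → ∃ n : ℤ, w.le n Z ∧ w.ge (-n) Z) :
    ∀ Z, triangulatedSubcategoryGeneratedBy G Z → ∃ n : ℤ, w.le n Z ∧ w.ge (-n) Z := by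
  let P : ObjectProperty C := fun Z => ∃ n : ℤ, w.le n Z ∧ w.ge (-n) Z
  have hP : P.IsClosedUnderIsomorphisms :=
    ⟨fun e ⟨n, h₁, h₂⟩ => ⟨n, (w.le n).prop_of_iso e h₁, (w.ge (-n)).prop_of_iso e h₂⟩⟩
  have : P.IsTriangulated :=
    { exists_zero := ⟨0, isZero_zero C, 0, w.le_of_isZero _ (isZero_zero C),
        w.ge_of_isZero _ (isZero_zero C)⟩
      isStableUnderShiftBy := fun a => ⟨fun N ⟨n, h₁, h₂⟩ => ⟨n + |a|,
        w.le_mono (n := n + a) (by linarith [le_abs_self a]) ((w.le_shift_iff rfl N).2 h₁),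
        w.ge_anti (m := -n + a) (by linarith [neg_abs_le a]) ((w.ge_shift_iff rfl N).2 h₂)⟩⟩
      ext₂' := fun T hT ⟨n, h₁, h₂⟩ ⟨m, h₃, h₄⟩ => ObjectProperty.le_isoClosure _ _
        ⟨max n m, w.le_obj₂ hT (w.le_mono (le_max_left n m) h₁) (w.le_mono (le_max_right n m) h₃),
          w.ge_obj₂ hT (w.ge_anti (by linarith [le_max_left n m]) h₂)
            (w.ge_anti (by linarith [le_max_right n m]) h₄)⟩ }
  exact fun Z hZ => hZ P this hP hG

end WeightStructure

end Quotient

/-! ### The induced weight structure and representatives of its heart. -/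

section Quotient

set_option linter.unusedSectionVars false

open Category ZeroObject

variable {C : Type u} [Category.{v} C] [HasZeroObject C] [HasShift C ℤ] [Preadditive C]
  [∀ n : ℤ, (shiftFunctor C n).Additive] [Pretriangulated C]
  {E : Type u'} [Category.{v'} E] [HasZeroObject E] [HasShift E ℤ] [Preadditive E]
  [∀ n : ℤ, (shiftFunctor E n).Additive] [Pretriangulated E]

namespace WeightStructure

variable (w : WeightStructure C) {L : C ⥤ E} [L.CommShift ℤ] [L.IsTriangulated]

variable {w} in
lemma IsWeightExact.le_map {w' : WeightStructure E} (h : w.IsWeightExact w' L) {n : ℤ} {X : C}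
    (hX : w.le n X) : w'.le n (L.obj X) :=
  w'.leZero.prop_of_iso ((L.commShiftIso (-n)).app X) (h.1 _ hX)

variable {w} in
lemma IsWeightExact.ge_map {w' : WeightStructure E} (h : w.IsWeightExact w' L) {n : ℤ} {X : C}
    (hX : w.ge n X) : w'.ge n (L.obj X) :=
  w'.geZero.prop_of_iso ((L.commShiftIso (-n)).app X) (h.2 _ hX)

/-- The weight structure whose classes are the retract-closures of the images of the classes
of `w`. -/
lemma exists_isInduced [L.EssSurj]
    (horth : ∀ ⦃X Y : C⦄, w.le 0 X → w.ge 1 Y → ∀ f : L.obj X ⟶ L.obj Y, f = 0) :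
    ∃ w' : WeightStructure E, w.IsInduced w' L := by
  let w' : WeightStructure E :=
    { leZero := fun Z => ∃ X, w.leZero X ∧ Nonempty (Retract Z (L.obj X))
      geZero := fun Z => ∃ X, w.geZero X ∧ Nonempty (Retract Z (L.obj X))
      leZero_retract := ⟨fun r ⟨X, hX, ⟨r'⟩⟩ => ⟨X, hX, ⟨r.trans r'⟩⟩⟩
      geZero_retract := ⟨fun r ⟨X, hX, ⟨r'⟩⟩ => ⟨X, hX, ⟨r.trans r'⟩⟩⟩
      leZero_shift := fun Z ⟨X, hX, ⟨r⟩⟩ => ⟨X⟦(-1 : ℤ)⟧, w.leZero_shift X hX,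
        ⟨(r.map (shiftFunctor E (-1 : ℤ))).trans
          (Retract.ofIso ((L.commShiftIso (-1 : ℤ)).app X).symm)⟩⟩
      geZero_shift := fun Z ⟨X, hX, ⟨r⟩⟩ => ⟨X⟦(1 : ℤ)⟧, w.geZero_shift X hX,
        ⟨(r.map (shiftFunctor E (1 : ℤ))).trans
          (Retract.ofIso ((L.commShiftIso (1 : ℤ)).app X).symm)⟩⟩
      orthogonal := by
        rintro Z W ⟨X, hX, ⟨r⟩⟩ ⟨Y, hY, ⟨r'⟩⟩ f
        have h₀ := horth ((w.le_zero_iff X).2 hX) (Y := Y⟦(1 : ℤ)⟧)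
          ((w.ge_shift_iff (by lia) Y).2 ((w.ge_zero_iff Y).2 hY))
          (r.r ≫ f ≫ r'.i⟦(1 : ℤ)⟧' ≫ (L.commShiftIso (1 : ℤ)).inv.app Y)
        have h₁ : f = r.i ≫ (r.r ≫ f ≫ r'.i⟦(1 : ℤ)⟧' ≫ (L.commShiftIso (1 : ℤ)).inv.app Y) ≫
            (L.commShiftIso (1 : ℤ)).hom.app Y ≫ r'.r⟦(1 : ℤ)⟧' := by
          simp [← Functor.map_comp]
        rw [h₁, h₀, zero_comp, comp_zero]
      exists_decomposition := fun M => by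
        obtain ⟨X, Y, f, g, h, hX, hY, hT⟩ := w.exists_decomposition (L.objPreimage M)
        let e := (L.commShiftIso (1 : ℤ)).app Y
        refine ⟨L.obj X, L.obj Y, L.map f ≫ (L.objObjPreimageIso M).hom,
          (L.objObjPreimageIso M).inv ≫ L.map g ≫ e.hom,
          e.inv ≫ L.map h ≫ (L.commShiftIso (1 : ℤ)).hom.app X, ⟨X, hX, ⟨Retract.refl _⟩⟩,
          ⟨Y, hY, ⟨Retract.refl _⟩⟩, ?_⟩
        exact distTriang_of_iso (map_distTriang L hT) (Iso.refl _) (L.objObjPreimageIso M).symm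
          e.symm (by simp) (by simp) (by simp) }
  refine ⟨w', ⟨fun X hX => ⟨X, hX, ⟨Retract.refl _⟩⟩, fun X hX => ⟨X, hX, ⟨Retract.refl _⟩⟩⟩,
    -- Any competitor is retract-closed and contains the images, so it is comparable with `w'`.
    fun w'' hw'' => eq_of_le ?_ ?_⟩
  · rintro Z ⟨X, hX, ⟨r⟩⟩
    exact w''.leZero.prop_of_retract r (hw''.1 X hX)
  · rintro Z ⟨X, hX, ⟨r⟩⟩
    exact w''.geZero.prop_of_retract r (hw''.2 X hX)

variable [IsTriangulated C] {D : ObjectProperty C} [D.IsTriangulated] [L.IsLocalization D.trW]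

section

variable {K : MorphismProperty (Arrow C)}

variable (D) in
-- A morphism killing the map to the cone of a denominator factors through the denominator, so it
-- can serve as the new one. The new source keeps weight `≤ 0`.
lemma exists_roof (hK : ∀ ⦃p p' : Arrow C⦄ (φ : p ⟶ p'), K φ → IsIso (L.map φ.left))
    (happ : D ≤ w.Approximable K) {p : Arrow C} (hp : w.IsHeartQuotient p.hom) {Y : C}
    (ψ : L.obj p.left ⟶ L.obj Y) :
    ∃ (p' : Arrow C) (φ : p' ⟶ p) (g : p'.left ⟶ Y), w.IsHeartQuotient p'.hom ∧ K φ ∧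
      IsIso (L.map φ.left) ∧ L.map φ.left ≫ ψ = L.map g := by
  obtain ⟨ψ, rfl⟩ := Localization.exists_rightFraction L D.trW ψ
  obtain ⟨N, a, b, hT, hN⟩ := ψ.hs
  obtain ⟨p', φ, hp', hφ, hφa⟩ := happ N hN hp a
  obtain ⟨k, hk⟩ := distTriang_exists_lift hT φ.left hφa
  refine ⟨p', φ, k ≫ ψ.f, hp', hφ, hK _ hφ, ?_⟩
  rw [hk, L.map_comp, assoc, ψ.map_s_comp_map, L.map_comp]

variable (D) in
lemma map_orth (hK : ∀ ⦃p p' : Arrow C⦄ (φ : p ⟶ p'), K φ → IsIso (L.map φ.left))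
    (happ : D ≤ w.Approximable K) {X Y : C} (hX : w.le 0 X) (hY : w.ge 1 Y)
    (ψ : L.obj X ⟶ L.obj Y) : ψ = 0 := by
  obtain ⟨H, p, hp⟩ := w.exists_isHeartQuotient hX
  obtain ⟨p', φ, g, hp', -, _, h⟩ := w.exists_roof D hK happ (p := Arrow.mk p) hp ψ
  rw [← cancel_epi (L.map φ.left), h, w.orth (by lia) hp'.le_zero hY g, L.map_zero, comp_zero]

end

variable {w} in
/-- An object of the heart of an induced weight structure is a retract of the image of an object
of the heart. -/
lemma IsWeightExact.exists_retract {w' : WeightStructure E} (h : w.IsWeightExact w' L) {M : C}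
    (hM : w'.heart (L.obj M)) : ∃ H, w.heart H ∧ Nonempty (Retract (L.obj M) (L.obj H)) := by
  rw [heart_iff] at hM
  obtain ⟨A, B, f, g, k, hA, hB, hT⟩ := w.exists_decomposition_le 0 1 (by lia) M
  obtain ⟨A', H, f', g', k', hA', hH, hT'⟩ := w.exists_decomposition_le (-1) 0 (by lia) A
  obtain ⟨i, hi⟩ := distTriang_exists_lift (map_distTriang L hT) (𝟙 (L.obj M))
    (by rw [w'.orth (by lia) hM.2 (h.ge_map hB) (L.map g), comp_zero])
  obtain ⟨r, hr⟩ := distTriang_exists_desc (map_distTriang L hT') (L.map f)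
    (w'.orth (by lia) (h.le_map hA') hM.1 _)
  exact ⟨H, (w.heart_iff H).2 ⟨hH, w.le_obj₃ hT' (by lia) hA' hA⟩,
    ⟨i ≫ L.map g', r, by rw [assoc, ← hr, hi]⟩⟩

variable (D) in
/-- If `D` consists of bounded objects, an object whose image is a retract of the image of a
bounded object is isomorphic, in the localization, to a bounded object. -/
lemma exists_bounded_of_retract (hD : ∀ N, D N → ∃ n : ℤ, w.le n N ∧ w.ge (-n) N) {M H : C}
    (hH : w.heart H) (r : Retract (L.obj M) (L.obj H)) :
    ∃ (M' : C) (n : ℕ), w.le n M' ∧ w.ge (-n) M' ∧ Nonempty (L.obj M' ≅ L.obj M) := by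
  rw [heart_iff] at hH
  obtain ⟨φ, hφ⟩ := Localization.exists_rightFraction L D.trW r.i
  obtain ⟨ψ, hψ⟩ := Localization.exists_leftFraction L D.trW r.r
  have e : L.map (φ.s ≫ ψ.s) = L.map (φ.f ≫ ψ.f) := by
    rw [L.map_comp, L.map_comp, ← φ.map_s_comp_map L (Localization.inverts L D.trW),
      ← ψ.map_comp_map_s L (Localization.inverts L D.trW), ← hφ, ← hψ, assoc, r.retract_assoc]
  obtain ⟨Z, t, ht, e'⟩ := (MorphismProperty.map_eq_iff_postcomp L D.trW _ _).1 e
  have hσ : D.trW ((φ.s ≫ ψ.s) ≫ t) :=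
    D.trW.comp_mem _ _ (D.trW.comp_mem _ _ φ.hs ψ.hs) ht
  have hs : IsIso (L.map φ.s) := Localization.inverts L D.trW _ φ.hs
  rw [e'] at hσ
  obtain ⟨N, a, b, hT, hN⟩ := hσ
  obtain ⟨n, hn, hn'⟩ := hD N hN
  obtain ⟨a', b', hT'⟩ := exists_invRotate_distTriang hT
  refine ⟨φ.X', n.natAbs + 1, ?_, ?_, ⟨asIso (L.map φ.s)⟩⟩
  · refine w.le_of_orth rfl fun Y hY x => ?_
    obtain ⟨y, rfl⟩ := distTriang_exists_desc hT' x
      (w.orth (n := n - 1) (by lia) ((w.le_shift_iff (by lia) N).2 hn) hY _)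
    rw [assoc, assoc, w.orth (by lia) hH.2 hY (ψ.f ≫ t ≫ y), comp_zero]
  · refine w.ge_of_orth (n := -(n.natAbs + 1 : ℕ) - 1) (by lia) fun Y hY x => ?_
    obtain ⟨y, rfl⟩ := distTriang_exists_lift hT' x (by
      rw [← assoc, ← assoc, w.orth (by lia) hY hH.1 (x ≫ φ.f), zero_comp, zero_comp])
    rw [w.orth (m := -n - 1) (by lia) hY ((w.ge_shift_iff (by lia) N).2 hn') y, zero_comp]

section Steps

variable {T : MorphismProperty C}

variable (D) in
/-- An object of weights `≤ 1` whose image has weights `≤ 0` may be replaced by one of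
weights `≤ 0`. -/
lemma exists_le_zero
    (hOre : ∀ ⦃H' H Y : C⦄ (s : H' ⟶ H) (g : H' ⟶ Y), T s → w.heart Y →
      ∃ (Y' : C) (t : Y ⟶ Y') (r : H ⟶ Y'), w.heart Y' ∧ IsIso (L.map t) ∧ s ≫ r = g ≫ t)
    (happ : D ≤ w.Approximable (invertedLeft L T)) {M : C} (hM : w.le 1 M)
    (hM' : ∀ Z, w.ge 1 Z → ∀ f : L.obj M ⟶ L.obj Z, f = 0) :
    ∃ M', w.le 0 M' ∧ (∀ n ≤ -1, w.ge n M → w.ge n M') ∧ Nonempty (L.obj M' ≅ L.obj M) := by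
  obtain ⟨A, B, f, g, h, hA, hB, hdec⟩ := w.exists_decomposition M
  rw [← le_zero_iff] at hA
  rw [← ge_zero_iff] at hB
  obtain ⟨u, hu⟩ := exists_distTriang_of_shift hdec
  have hB' : w.le 0 B := w.le_obj₁ hu rfl hA hM
  have hg : L.map g = 0 := hM' _ ((w.ge_shift_iff (by lia) B).2 hB) _
  have : Mono (L.map u) := Triangle.mono₁ _ (map_distTriang L hu)
    (show L.map g ≫ _ = 0 by rw [hg, zero_comp])
  have : IsSplitMono (L.map u) := isSplitMono_of_mono _
  obtain ⟨H, p, hp⟩ := w.exists_isHeartQuotient hA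
  obtain ⟨p', φ, k, hp', hφ, _, hk⟩ :=
    w.exists_roof D (fun _ _ _ h => h.1) happ (p := Arrow.mk p) hp (retraction (L.map u))
  have e : φ.left ≫ p = p'.hom ≫ φ.right := φ.w
  obtain ⟨k', rfl⟩ := hp'.exists_desc hB k
  obtain ⟨B', t, r, hB'', _, e'⟩ := hOre φ.right k' hφ.2 ((w.heart_iff B).2 ⟨hB, hB'⟩)
  rw [heart_iff] at hB''
  have hr : L.map (p ≫ r) = retraction (L.map u) ≫ L.map t := by
    rw [← cancel_epi (L.map φ.left), ← L.map_comp, reassoc_of% e, reassoc_of% hk, e']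
    simp
  obtain ⟨F, z, c, hF⟩ := distinguished_cocone_triangle₁ (p ≫ r)
  refine ⟨F, w.le_obj₁ hF rfl hA (w.le_mono (by lia) hB''.2), fun n hn hMn => ?_, ?_⟩
  · exact w.ge_obj₁ hF rfl (w.ge_obj₂ hu (w.ge_anti (by lia) hB) hMn)
      (w.ge_anti (by lia) hB''.1)
  · have := isIso_map_fibre_to_cone L hu hF (by
      rw [hr, IsSplitMono.id_assoc]; infer_instance)
    exact ⟨asIso (L.map (z ≫ f))⟩

variable (D) in
/-- An object of weights `≥ -1` whose image has weights `≥ 0` may be replaced by one of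
weights `≥ 0`. -/
lemma exists_ge_zero (hT : ∀ ⦃X Y : C⦄ (s : X ⟶ Y), T s → IsIso (L.map s))
    (happ : D ≤ w.Approximable (invertedLeft L T)) {M : C} (hM : w.ge (-1) M)
    (hM' : ∀ Z, w.le (-1) Z → ∀ f : L.obj Z ⟶ L.obj M, f = 0) :
    ∃ M', w.ge 0 M' ∧ (∀ n ≥ 1, w.le n M → w.le n M') ∧ Nonempty (L.obj M' ≅ L.obj M) := by
  obtain ⟨A, B, f, g, h, hA, hB, hdec⟩ := w.exists_decomposition_le (-1) 0 (by lia) M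
  have hH : w.heart (A⟦(1 : ℤ)⟧) := (w.heart_iff _).2
    ⟨(w.ge_shift_iff (by lia) A).2 (w.ge_obj₁ hdec (by lia) hM hB),
      (w.le_shift_iff (by lia) A).2 hA⟩
  obtain ⟨σ, hσ⟩ := exists_section_map L hdec (hM' A hA (L.map f))
  obtain ⟨p', φ, k, hp', hφ, _, hk⟩ := w.exists_roof D (fun _ _ _ h => h.1) happ
    (p := Arrow.mk (𝟙 (A⟦(1 : ℤ)⟧))) (w.isHeartQuotient_of_isIso hH (𝟙 _)) σ
  obtain ⟨s, hs⟩ : ∃ s : p'.right ⟶ A⟦(1 : ℤ)⟧, s = φ.right := ⟨_, rfl⟩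
  obtain ⟨u, rfl⟩ := hp'.exists_desc hB k
  have hH' := (w.heart_iff _).1 hp'.1
  have e : L.map φ.left = L.map p'.hom ≫ L.map s := by
    rw [← L.map_comp, hs, ← φ.w]; simp
  have := hT s (hs ▸ hφ.2)
  rw [e] at hk ‹IsIso (L.map φ.left)›
  have : IsIso (L.map p'.hom) := IsIso.of_isIso_comp_right _ (L.map s)
  have hu : L.map u = L.map s ≫ σ := by
    rw [← cancel_epi (L.map p'.hom), ← L.map_comp, ← hk, assoc]
  obtain ⟨R, y, c, hR⟩ := distinguished_cocone_triangle u
  refine ⟨R, w.ge_obj₃ hR (n := -1) (by lia) (w.ge_anti (by lia) hH'.1) hB, fun n hn hMn => ?_, ?_⟩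
  · exact w.le_obj₃ hR (n := n - 1) (by lia) (w.le_mono (by lia) hH'.2)
      (w.le_obj₂ (rotate_distTriang hdec) hMn (w.le_mono (by lia) ((w.heart_iff _).1 hH).2))
  · have := isIso_map_fibre_to_cone L hR (rotate_distTriang hdec) (by
      rw [hu, assoc, hσ, comp_id]; infer_instance)
    exact ⟨(asIso (L.map (g ≫ y))).symm⟩

/-- An object of weights `-1` and `0` whose image has weights `≥ 0` may be replaced by an object
of the heart when `L` is full on the heart, with a controlled kernel. -/
lemma exists_heart_of_between
    (hfull : ∀ ⦃H B : C⦄, w.heart H → w.heart B → ∀ φ : L.obj H ⟶ L.obj B, ∃ v, L.map v = φ)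
    (hker : ∀ ⦃H B : C⦄, w.heart H → w.heart B → ∀ δ : H ⟶ B, L.map δ = 0 →
      ∃ (N : C) (α : H ⟶ N) (β : N ⟶ B), w.heart N ∧ IsZero (L.obj N) ∧ α ≫ β = δ)
    {M : C} (hM : w.ge (-1) M) (hM₀ : w.le 0 M)
    (hM' : ∀ Z, w.le (-1) Z → ∀ f : L.obj Z ⟶ L.obj M, f = 0) :
    ∃ M', w.heart M' ∧ Nonempty (L.obj M' ≅ L.obj M) := by
  obtain ⟨A, B, f, g, h, hA, hB, hdec⟩ := w.exists_decomposition_le (-1) 0 (by lia) M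
  have hH : w.heart (A⟦(1 : ℤ)⟧) := (w.heart_iff _).2
    ⟨(w.ge_shift_iff (by lia) A).2 (w.ge_obj₁ hdec (by lia) hM hB),
      (w.le_shift_iff (by lia) A).2 hA⟩
  have hB₀ : w.le 0 B := w.le_obj₂ (rotate_distTriang hdec) hM₀ ((w.heart_iff _).1 hH).2
  obtain ⟨σ, hσ⟩ := exists_section_map L hdec (hM' A hA (L.map f))
  obtain ⟨v, rfl⟩ := hfull hH ((w.heart_iff _).2 ⟨hB, hB₀⟩) σ
  obtain ⟨N, α, β, hN, hN₀, hαβ⟩ := hker hH hH (𝟙 _ - v ≫ h) (by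
    rw [L.map_sub, L.map_comp, hσ, L.map_id, sub_self])
  rw [heart_iff] at hN
  have hlift : biprod.lift v α ≫ biprod.desc h β = 𝟙 _ := by
    rw [biprod.lift_desc, hαβ]; abel
  have hsplit : Epi (biprod.desc h β) := (SplitEpi.mk _ hlift).epi
  obtain ⟨X, z, c, hX⟩ := distinguished_cocone_triangle₁ (biprod.desc h β)
  have hz : Mono z := Triangle.mono₁ _ hX (Triangle.mor₃_eq_zero_of_epi₂ _ hX hsplit)
  have := isSplitMono_of_mono z
  let ρ : Retract X (B ⊞ N) := ⟨z, retraction z, IsSplitMono.id z⟩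
  have hBN := binaryBiproductTriangle_distinguished B N
  obtain ⟨a, ha, ha'⟩ := complete_distinguished_triangle_morphism₁ _ _ (rotate_distTriang hdec) hX
    (biprod.inl : B ⟶ B ⊞ N) (𝟙 _) (show h ≫ 𝟙 _ = biprod.inl ≫ biprod.desc h β by simp)
  let φ : Triangle.mk g h (-f⟦(1 : ℤ)⟧') ⟶ Triangle.mk z (biprod.desc h β) c :=
    { hom₁ := a
      hom₂ := biprod.inl
      hom₃ := 𝟙 _
      comm₁ := ha
      comm₂ := show h ≫ 𝟙 _ = biprod.inl ≫ biprod.desc h β by simp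
      comm₃ := ha' }
  have : IsIso (L.map a) := isIso₁_of_isIso₂₃ (L.mapTriangle.map φ)
    (L.map_distinguished _ (rotate_distTriang hdec)) (L.map_distinguished _ hX)
    (isIso_map_of_isZero L hBN hN₀) (inferInstanceAs (IsIso (L.map (𝟙 _))))
  exact ⟨X, (w.heart_iff X).2 ⟨(w.ge 0).prop_of_retract ρ (w.ge_obj₂ hBN hB hN.1),
    (w.le 0).prop_of_retract ρ (w.le_obj₂ hBN hB₀ hN.2)⟩, ⟨(asIso (L.map a)).symm⟩⟩

end Steps

variable {w} in
variable (D) in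
/-- Objects of the heart of the induced weight structure come from objects of weights
`-1` and `0`. -/
lemma IsWeightExact.exists_between {w' : WeightStructure E} (hw : w.IsWeightExact w' L)
    (hD : ∀ N, D N → ∃ n : ℤ, w.le n N ∧ w.ge (-n) N) {T : MorphismProperty C}
    (hT : ∀ ⦃X Y : C⦄ (s : X ⟶ Y), T s → IsIso (L.map s))
    (hOre : ∀ ⦃H' H Y : C⦄ (s : H' ⟶ H) (g : H' ⟶ Y), T s → w.heart Y →
      ∃ (Y' : C) (t : Y ⟶ Y') (r : H ⟶ Y'), w.heart Y' ∧ IsIso (L.map t) ∧ s ≫ r = g ≫ t)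
    (happ : D ≤ w.Approximable (invertedLeft L T)) {M : C}
    (hM : w'.heart (L.obj M)) :
    ∃ X, w.ge (-1) X ∧ w.le 0 X ∧ Nonempty (L.obj X ≅ L.obj M) := by
  have upper : ∀ (k m : ℕ) (M : C), w'.heart (L.obj M) → w.le k M → w.ge (-(m + 1)) M →
      ∃ X, w.le 0 X ∧ w.ge (-(m + 1)) X ∧ Nonempty (L.obj X ≅ L.obj M) := by
    intro k m
    induction k with
    | zero => exact fun M _ h₁ h₂ => ⟨M, h₁, h₂, ⟨Iso.refl _⟩⟩
    | succ k ih =>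
      intro M hM h₁ h₂
      have h₃ : w'.le (-k) (L.obj (M⟦-(k : ℤ)⟧)) := (w'.le _).prop_of_iso
        ((L.commShiftIso (-(k : ℤ))).app M).symm
        ((w'.le_shift_iff (n := 0) (by lia) _).2 ((w'.heart_iff _).1 hM).2)
      obtain ⟨X, hX, hX', e⟩ := w.exists_le_zero D hOre happ (M := M⟦-(k : ℤ)⟧)
        ((w.le_shift_iff (n := (k + 1 : ℕ)) (by lia) M).2 h₁)
        (fun Z hZ f => w'.orth (by lia) h₃ (hw.ge_map hZ) f)
      obtain ⟨e⟩ := nonempty_iso_of_shift (b := k) (by lia) e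
      obtain ⟨Y, hY, hY', ⟨e'⟩⟩ := ih (X⟦(k : ℤ)⟧) (w'.heart_of_iso e.symm hM)
        ((w.le_shift_iff (by lia) X).2 hX)
        ((w.ge_shift_iff (by lia) X).2 (hX' (-(m + 1) - k) (by lia)
          ((w.ge_shift_iff (by lia) M).2 h₂)))
      exact ⟨Y, hY, hY', ⟨e' ≪≫ e⟩⟩
  have lower : ∀ (k : ℕ) (M : C), w'.heart (L.obj M) → w.ge (-(k + 1)) M → w.le 0 M →
      ∃ X, w.ge (-1) X ∧ w.le 0 X ∧ Nonempty (L.obj X ≅ L.obj M) := by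
    intro k
    induction k with
    | zero => exact fun M _ h₁ h₂ => ⟨M, h₁, h₂, ⟨Iso.refl _⟩⟩
    | succ k ih =>
      intro M hM h₁ h₂
      have h₃ : w'.ge (k + 1) (L.obj (M⟦(k + 1 : ℤ)⟧)) := (w'.ge _).prop_of_iso
        ((L.commShiftIso (k + 1 : ℤ)).app M).symm
        ((w'.ge_shift_iff (n := 0) (by lia) _).2 ((w'.heart_iff _).1 hM).1)
      obtain ⟨X, hX, hX', e⟩ := w.exists_ge_zero D hT happ (M := M⟦(k + 1 : ℤ)⟧)
        ((w.ge_shift_iff (n := -((k + 1 : ℕ) + 1)) (by lia) M).2 h₁)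
        (fun Z hZ f => w'.orth (by lia) (hw.le_map hZ) h₃ f)
      obtain ⟨e⟩ := nonempty_iso_of_shift (b := -(k + 1)) (by lia) e
      obtain ⟨Y, hY, hY', ⟨e'⟩⟩ := ih (X⟦(-(k + 1) : ℤ)⟧) (w'.heart_of_iso e.symm hM)
        ((w.ge_shift_iff (by lia) X).2 hX)
        ((w.le_shift_iff (by lia) X).2 (hX' (k + 1) (by lia) ((w.le_shift_iff (by lia) M).2 h₂)))
      exact ⟨Y, hY, hY', ⟨e' ≪≫ e⟩⟩
  obtain ⟨H, hH, ⟨r⟩⟩ := hw.exists_retract hM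
  obtain ⟨M₁, n, h₁, h₂, ⟨e₁⟩⟩ := w.exists_bounded_of_retract D hD hH r
  obtain ⟨M₂, h₃, h₄, ⟨e₂⟩⟩ := upper n n M₁ (w'.heart_of_iso e₁.symm hM) h₁
    (w.ge_anti (by lia) h₂)
  obtain ⟨M₃, h₅, h₆, ⟨e₃⟩⟩ := lower n M₂ (w'.heart_of_iso (e₁.symm ≪≫ e₂.symm) hM) h₄ h₃
  exact ⟨M₃, h₅, h₆, ⟨e₃ ≪≫ e₂ ≪≫ e₁⟩⟩

end WeightStructure

end Quotient

section Quotient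

set_option linter.unusedSectionVars false

open Category ZeroObject

variable {C : Type u} [Category.{v} C] [HasZeroObject C] [HasShift C ℤ] [Preadditive C]
  [∀ n : ℤ, (shiftFunctor C n).Additive] [Pretriangulated C] [IsTriangulated C]
  {E : Type u'} [Category.{v'} E] [HasZeroObject E] [HasShift E ℤ] [Preadditive E]
  [∀ n : ℤ, (shiftFunctor E n).Additive] [Pretriangulated E]

lemma le_triangulatedSubcategoryGeneratedBy (G : ObjectProperty C) :
    G ≤ triangulatedSubcategoryGeneratedBy G :=
  fun _ hX _ _ _ hG => hG _ hX

namespace WeightStructure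

variable (w : WeightStructure C) (L : C ⥤ E) [L.CommShift ℤ] [L.IsTriangulated]

section HeartGenerators

/-- `δ` factors through an object of the heart that is killed by `L`. -/
def FactorsThroughKernel {X Y : C} (δ : X ⟶ Y) : Prop :=
  ∃ (N : C) (α : X ⟶ N) (β : N ⟶ Y), w.heart N ∧ IsZero (L.obj N) ∧ α ≫ β = δ

variable {w L} in
lemma FactorsThroughKernel.add {X Y : C} {δ δ' : X ⟶ Y} (h : w.FactorsThroughKernel L δ)
    (h' : w.FactorsThroughKernel L δ') : w.FactorsThroughKernel L (δ + δ') := by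
  obtain ⟨N, α, β, hN, hN₀, rfl⟩ := h
  obtain ⟨N', α', β', hN', hN₀', rfl⟩ := h'
  have hT := binaryBiproductTriangle_distinguished N N'
  rw [heart_iff] at hN hN'
  exact ⟨N ⊞ N', biprod.lift α α', biprod.desc β β',
    (w.heart_iff _).2 ⟨w.ge_obj₂ hT hN.1 hN'.1, w.le_obj₂ hT hN.2 hN'.2⟩,
    Triangle.isZero₂_of_isZero₁₃ _ (map_distTriang L hT) hN₀ hN₀', biprod.lift_desc⟩

/-- The morphisms between parts of weight `≤ 0` that are invertible on parts of weight zero and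
detect the morphisms that factor through the kernel of `L`. -/
def detectsKernel : MorphismProperty (Arrow C) := fun p' p φ =>
  invertedLeft L (MorphismProperty.isomorphisms C) φ ∧
    (w.IsHeartQuotient p.hom → w.IsHeartQuotient p'.hom ∧
      ∀ ⦃Y : C⦄ (δ : p.left ⟶ Y), w.heart Y → φ.left ≫ δ = 0 → w.FactorsThroughKernel L δ)

lemma factorsThroughKernel_zero (X Y : C) : w.FactorsThroughKernel L (0 : X ⟶ Y) :=
  ⟨0, 0, 0, (w.heart_iff 0).2 ⟨w.ge_of_isZero 0 (isZero_zero C), w.le_of_isZero 0 (isZero_zero C)⟩,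
    L.map_isZero (isZero_zero C), by simp⟩

instance : (w.detectsKernel L).IsMultiplicative where
  id_mem p := ⟨(invertedLeft L _).id_mem p, fun hp => ⟨hp, fun Y δ _ hδ => by
    rw [Arrow.id_left, id_comp] at hδ
    exact hδ ▸ w.factorsThroughKernel_zero L _ _⟩⟩
  comp_mem {p₁ p₂ p₃} φ ψ hφ hψ := ⟨(invertedLeft L _).comp_mem _ _ hφ.1 hψ.1, fun hp => by
    obtain ⟨hp₂, hker⟩ := hψ.2 hp
    obtain ⟨hp₁, hker'⟩ := hφ.2 hp₂
    refine ⟨hp₁, fun Y δ hY hδ => ?_⟩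
    rw [Arrow.comp_left, assoc] at hδ
    obtain ⟨N, α, β, hN, hN₀, e⟩ := hker' _ hY hδ
    obtain ⟨α', rfl⟩ := hp₂.exists_desc ((w.heart_iff N).1 hN).1 α
    have : IsIso ψ.right := hψ.1.2
    have hα : ψ.left ≫ p₃.hom ≫ inv ψ.right ≫ α' = p₂.hom ≫ α' := by
      have hw : ψ.left ≫ p₃.hom = p₂.hom ≫ ψ.right := ψ.w
      rw [reassoc_of% hw, IsIso.hom_inv_id_assoc]
    have h₁ : w.FactorsThroughKernel L ((p₃.hom ≫ inv ψ.right ≫ α') ≫ β) :=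
      ⟨N, _, β, hN, hN₀, rfl⟩
    have h₂ := hker (δ - (p₃.hom ≫ inv ψ.right ≫ α') ≫ β) hY (by
      rw [Preadditive.comp_sub, ← assoc, hα, e, sub_self])
    simpa using h₁.add h₂⟩

lemma approximable_detectsKernel {N : C} (hN : w.heart N ∨ w.le (-1) N)
    (hN₀ : IsZero (L.obj N)) : w.Approximable (w.detectsKernel L) N := by
  intro p hp f
  have hN' : w.le 0 N := hN.elim (fun h => ((w.heart_iff N).1 h).2) (w.le_mono (by lia))
  obtain ⟨p', φ, b, hp', hφ, hT⟩ :=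
    w.exists_fibre_of_le L (MorphismProperty.isomorphisms C) hp hN' hN₀ f
  refine ⟨p', φ, hp', ⟨hφ, fun _ => ⟨hp', fun Y δ hY hδ => ?_⟩⟩, distTriang_comp_eq_zero hT⟩
  obtain ⟨β, rfl⟩ := distTriang_exists_desc hT δ hδ
  obtain h | h := hN
  · exact ⟨N, f, β, h, hN₀, rfl⟩
  · rw [w.orth (by lia) h ((w.heart_iff Y).1 hY).1 β, comp_zero]
    exact w.factorsThroughKernel_zero L _ _

variable (G : ObjectProperty C) [L.IsLocalization (triangulatedSubcategoryGeneratedBy G).trW]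

theorem exists_isInduced_of_le_heart (hG : G ≤ w.heart) :
    ∃ w' : WeightStructure E, w.IsInduced w' L ∧
      ∀ Y : E, w'.heart Y → ∃ X : C, w.heart X ∧ Nonempty (Y ≅ L.obj X) := by
  let D := triangulatedSubcategoryGeneratedBy G
  have hzero {N : C} (hN : D N) : IsZero (L.obj N) := isZero_obj_of_localization L D hN
  have : L.EssSurj := Localization.essSurj L D.trW
  have happ : D ≤ w.Approximable (w.detectsKernel L) := by
    refine w.approximable_of_generators _ G fun n Z hZ => ?_
    have hZ' := (w.heart_iff Z).1 (hG Z hZ)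
    have hZ₀ := hzero (D.le_shift n _ (le_triangulatedSubcategoryGeneratedBy G Z hZ))
    obtain h | rfl | h := lt_trichotomy n 0
    · exact w.approximable_detectsKernel L
        (Or.inr (w.le_mono (by lia) ((w.le_shift_iff (zero_add n) Z).2 hZ'.2))) hZ₀
    · exact w.approximable_detectsKernel L
        (Or.inl (w.heart_of_iso ((shiftFunctorZero C ℤ).symm.app Z) (hG Z hZ))) hZ₀
    · exact w.approximable_of_ge _
        (w.ge_anti (by lia) ((w.ge_shift_iff (zero_add n) Z).2 hZ'.1))
  have hK ⦃p p' : Arrow C⦄ (φ : p ⟶ p') (hφ : w.detectsKernel L φ) : IsIso (L.map φ.left) :=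
    hφ.1.1
  obtain ⟨w', hw'⟩ := w.exists_isInduced (L := L) fun X Y hX hY f => w.map_orth D hK happ hX hY f
  refine ⟨w', hw', fun Y hY => ?_⟩
  have hY' := w'.heart_of_iso (L.objObjPreimageIso Y).symm hY
  obtain ⟨M, hM, hM₀, ⟨e⟩⟩ := hw'.1.exists_between D
    (w.isBounded_generated G fun Z hZ => ⟨0, ((w.heart_iff Z).1 (hG Z hZ)).2, by
      simpa using ((w.heart_iff Z).1 (hG Z hZ)).1⟩)
    (T := MorphismProperty.isomorphisms C)
    (fun _ _ s (hs : IsIso s) => inferInstance)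
    (fun H' H Y s g (hs : IsIso s) hY => ⟨Y, 𝟙 Y, inv s ≫ g, hY, inferInstance, by simp⟩)
    (fun N hN p hp f => by
      obtain ⟨p', φ, hp', hφ, h⟩ := happ N hN hp f
      exact ⟨p', φ, hp', hφ.1, h⟩) hY'
  have hM' := (w'.heart_iff _).1 (w'.heart_of_iso e.symm hY')
  have hfull ⦃H B : C⦄ (hH : w.heart H) (hB : w.heart B) (ψ : L.obj H ⟶ L.obj B) :
      ∃ v, L.map v = ψ := by
    obtain ⟨p', φ, k, hp', hφ, _, hk⟩ := w.exists_roof D hK happ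
      (p := Arrow.mk (𝟙 H)) (w.isHeartQuotient_of_isIso hH (𝟙 H)) ψ
    obtain ⟨k', rfl⟩ := hp'.exists_desc ((w.heart_iff B).1 hB).1 k
    obtain ⟨s, hs⟩ : ∃ s : p'.right ⟶ H, s = φ.right := ⟨_, rfl⟩
    have : IsIso s := hs ▸ hφ.1.2
    have e : φ.left = p'.hom ≫ s := by rw [hs, ← φ.w]; simp
    refine ⟨inv s ≫ k', ?_⟩
    rw [← cancel_epi (L.map φ.left), hk, ← L.map_comp, e, assoc, IsIso.hom_inv_id_assoc]
  have hker ⦃H B : C⦄ (hH : w.heart H) (hB : w.heart B) (δ : H ⟶ B) (hδ : L.map δ = 0) :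
      w.FactorsThroughKernel L δ := by
    obtain ⟨X, t, ⟨N, a, b, hT, hN⟩, ht⟩ :=
      (MorphismProperty.map_eq_iff_precomp L D.trW δ 0).1 (by rw [hδ, L.map_zero])
    obtain ⟨p', φ, hp', hφ, h⟩ := happ N hN (p := Arrow.mk (𝟙 H))
      (w.isHeartQuotient_of_isIso hH (𝟙 H)) a
    obtain ⟨k, hk⟩ := distTriang_exists_lift hT φ.left h
    exact (hφ.2 (w.isHeartQuotient_of_isIso hH (𝟙 H))).2 δ hB (by
      rw [hk, assoc, ht, comp_zero, comp_zero])
  obtain ⟨X, hX, ⟨e'⟩⟩ := w.exists_heart_of_between (L := L) hfull hker hM hM₀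
    (fun Z hZ f => w'.orth (by lia) (hw'.1.le_map hZ) hM'.1 f)
  exact ⟨X, hX, ⟨(e' ≪≫ e ≪≫ L.objObjPreimageIso Y).symm⟩⟩

end HeartGenerators

section OreGenerators

/-- The morphisms inverted by `L` that admit pushout squares, up to morphisms inverted by `L`,
along morphisms to the heart. -/
def leftOreInverted : MorphismProperty C := fun H' H s => IsIso (L.map s) ∧
  ∀ ⦃Y : C⦄ (g : H' ⟶ Y), w.heart Y →
    ∃ (Y' : C) (t : Y ⟶ Y') (r : H ⟶ Y'), w.heart Y' ∧ IsIso (L.map t) ∧ s ≫ r = g ≫ t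

instance : (w.leftOreInverted L).IsMultiplicative where
  id_mem H := ⟨inferInstance, fun Y g hY => ⟨Y, 𝟙 Y, g, hY, inferInstance, by simp⟩⟩
  comp_mem s s' := fun ⟨_, h⟩ ⟨_, h'⟩ => ⟨by rw [L.map_comp]; infer_instance, fun Y g hY => by
    obtain ⟨Y', t, r, hY', _, e⟩ := h g hY
    obtain ⟨Y'', t', r', hY'', _, e'⟩ := h' r hY'
    exact ⟨Y'', t ≫ t', r', hY'', by rw [L.map_comp]; infer_instance, by
      rw [assoc, e', reassoc_of% e]⟩⟩

variable (S : MorphismProperty w.heart.FullSubcategory)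
  [L.IsLocalization (triangulatedSubcategoryGeneratedBy (conesOfHeartMorphisms w S)).trW]

lemma isIso_map_of_generator {X Y : w.heart.FullSubcategory} {s : X ⟶ Y} (hs : S s) :
    IsIso (L.map s.hom) := by
  obtain ⟨Z, g, h, hT⟩ := distinguished_cocone_triangle s.hom
  exact isIso_map_of_isZero L hT (isZero_obj_of_localization L _
    (le_triangulatedSubcategoryGeneratedBy (conesOfHeartMorphisms w S) Z ⟨X, Y, s, hs, g, h, hT⟩))

lemma leftOreInverted_of_generator (hl : LeftOreCondition S) {X Y : w.heart.FullSubcategory}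
    {s : X ⟶ Y} (hs : S s) : w.leftOreInverted L s.hom := by
  refine ⟨w.isIso_map_of_generator L S hs, fun B g hB => ?_⟩
  obtain ⟨A, t, r, ht, e⟩ := hl s (ObjectProperty.homMk (Y := ⟨B, hB⟩) g) hs
  exact ⟨A.obj, t.hom, r.hom, A.property, w.isIso_map_of_generator L S ht,
    (congrArg (fun k => k.hom) e).symm⟩

lemma approximable_cone (hl : LeftOreCondition S) (hr : RightOreCondition S) {Z : C}
    (hZ : conesOfHeartMorphisms w S Z) :
    w.Approximable (invertedLeft L (w.leftOreInverted L)) Z := by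
  intro p hp f
  obtain ⟨X, Y, s, hs, g, h, hT⟩ := hZ
  have hX := (w.heart_iff _).1 X.property
  have hY := (w.heart_iff _).1 Y.property
  have hZ : w.ge 0 Z := w.ge_obj₃ hT (n := -1) (by lia) (w.ge_anti (by lia) hX.1) hY.1
  obtain ⟨f, rfl⟩ := hp.exists_desc hZ f
  have hH := hp.1
  obtain ⟨c, rfl⟩ := distTriang_exists_lift₃ hT f (w.orth (n := 0) (m := 1) (by lia)
    ((w.heart_iff _).1 hH).2 ((w.ge_shift_iff (by lia) _).2 hX.1) _)
  obtain ⟨A, a, t, ha, e⟩ := hr s (ObjectProperty.homMk (X := ⟨p.right, hH⟩) c) hs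
  have e' : a.hom ≫ c = t.hom ≫ s.hom := congrArg (fun k => k.hom) e
  have ha' := w.leftOreInverted_of_generator L S hl ha
  obtain ⟨_, F, d, b, hF, hT'⟩ := hp
  obtain ⟨X', p', b', hT''⟩ := distinguished_cocone_triangle₁ (a.hom ≫ d)
  obtain ⟨q, hq, hq'⟩ : ∃ q : X' ⟶ p.left, p' ≫ a.hom = q ≫ p.hom ∧
      b' ≫ q⟦(1 : ℤ)⟧' = 𝟙 F ≫ b := complete_distinguished_triangle_morphism₁ _ _ hT'' hT' a.hom (𝟙 F)
    (show (a.hom ≫ d) ≫ 𝟙 F = a.hom ≫ d by simp)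
  let φ : Triangle.mk p' (a.hom ≫ d) b' ⟶ Triangle.mk p.hom d b :=
    { hom₁ := q
      hom₂ := a.hom
      hom₃ := 𝟙 F
      comm₁ := hq
      comm₂ := show (a.hom ≫ d) ≫ 𝟙 F = a.hom ≫ d by simp
      comm₃ := hq' }
  have : IsIso (L.map q) := isIso₁_of_isIso₂₃ (L.mapTriangle.map φ)
    (L.map_distinguished _ hT'') (L.map_distinguished _ hT') ha'.1
    (inferInstanceAs (IsIso (L.map (𝟙 F))))
  refine ⟨Arrow.mk p', Arrow.homMk q a.hom hq.symm, ⟨A.property, F, _, b', hF, hT''⟩,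
    ⟨this, ha'⟩, ?_⟩
  have hsg : s.hom ≫ g = 0 := distTriang_comp_eq_zero hT
  change q ≫ p.hom ≫ c ≫ g = 0
  rw [← reassoc_of% hq, reassoc_of% e', hsg, comp_zero, comp_zero]

theorem exists_isInduced_of_ore (hl : LeftOreCondition S) (hr : RightOreCondition S) :
    ∃ w' : WeightStructure E, w.IsInduced w' L ∧
      ∀ Y : E, w'.heart Y → ∃ X : C, w.between (-1) 0 X ∧ Nonempty (Y ≅ L.obj X) := by
  let G := conesOfHeartMorphisms w S
  let D := triangulatedSubcategoryGeneratedBy G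
  have : L.EssSurj := Localization.essSurj L D.trW
  have hG (Z : C) (hZ : G Z) : w.le 1 Z ∧ w.ge 0 Z := by
    obtain ⟨X, Y, s, hs, g, h, hT⟩ := hZ
    have hX := (w.heart_iff _).1 X.property
    have hY := (w.heart_iff _).1 Y.property
    exact ⟨w.le_obj₃ hT (by lia) hX.2 (w.le_mono (by lia) hY.2),
      w.ge_obj₃ hT (n := -1) (by lia) (w.ge_anti (by lia) hX.1) hY.1⟩
  have happ : D ≤ w.Approximable (invertedLeft L (w.leftOreInverted L)) := by
    refine w.approximable_of_generators _ G fun n Z hZ => ?_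
    obtain h | rfl | h := lt_trichotomy n 0
    · intro p hp f
      obtain ⟨p', φ, b, hp', hφ, hT⟩ := w.exists_fibre_of_le L (w.leftOreInverted L) hp
        (w.le_mono (by lia) ((w.le_shift_iff rfl Z).2 (hG Z hZ).1))
        (isZero_obj_of_localization L D
          (D.le_shift n _ (le_triangulatedSubcategoryGeneratedBy G Z hZ))) f
      exact ⟨p', φ, hp', hφ, distTriang_comp_eq_zero hT⟩
    · exact (w.Approximable _).prop_of_iso ((shiftFunctorZero C ℤ).symm.app Z)
        (w.approximable_cone L S hl hr hZ)
    · exact w.approximable_of_ge _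
        (w.ge_anti (by lia) ((w.ge_shift_iff (zero_add n) Z).2 (hG Z hZ).2))
  obtain ⟨w', hw'⟩ := w.exists_isInduced (L := L) fun X Y hX hY f =>
    w.map_orth D (fun _ _ _ h => h.1) happ hX hY f
  refine ⟨w', hw', fun Y hY => ?_⟩
  obtain ⟨X, hX, hX', ⟨e⟩⟩ := hw'.1.exists_between D
    (w.isBounded_generated G fun Z hZ => ⟨1, (hG Z hZ).1, w.ge_anti (by lia) (hG Z hZ).2⟩)
    (fun _ _ _ h => h.1) (fun _ _ _ _ g h hY => h.2 g hY) happ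
    (w'.heart_of_iso (L.objObjPreimageIso Y).symm hY)
  exact ⟨X, ⟨hX, hX'⟩, ⟨(e ≪≫ L.objObjPreimageIso Y).symm⟩⟩

end OreGenerators

end WeightStructure

end Quotient

theorem mainTheorem5 {C : Type u} [Category.{v} C] [HasZeroObject C] [HasShift C ℤ]
    [Preadditive C] [∀ n : ℤ, (shiftFunctor C n).Additive] [Pretriangulated C] [IsTriangulated C]
    (w : WeightStructure C) :
    (∀ G : ObjectProperty C, G ≤ w.heart →
      ∃ w' : WeightStructure (VerdierQuotient (triangulatedSubcategoryGeneratedBy G)),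
        w.IsInduced w' (verdierFunctor (triangulatedSubcategoryGeneratedBy G)) ∧
        ∀ Y : VerdierQuotient (triangulatedSubcategoryGeneratedBy G), w'.heart Y →
          ∃ X : C, w.heart X ∧
            Nonempty (Y ≅ (verdierFunctor (triangulatedSubcategoryGeneratedBy G)).obj X)) ∧
    (∀ S : MorphismProperty w.heart.FullSubcategory,
      LeftOreCondition S → RightOreCondition S →
      ∃ w' : WeightStructure (VerdierQuotient
          (triangulatedSubcategoryGeneratedBy (conesOfHeartMorphisms w S))),
        w.IsInduced w' (verdierFunctor
          (triangulatedSubcategoryGeneratedBy (conesOfHeartMorphisms w S))) ∧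
        ∀ Y : VerdierQuotient (triangulatedSubcategoryGeneratedBy (conesOfHeartMorphisms w S)),
          w'.heart Y →
          ∃ X : C, w.between (-1) 0 X ∧
            Nonempty (Y ≅ (verdierFunctor
              (triangulatedSubcategoryGeneratedBy (conesOfHeartMorphisms w S))).obj X)) :=
  ⟨fun G hG => w.exists_isInduced_of_le_heart _ G hG,
    fun S hl hr => w.exists_isInduced_of_ore _ S hl hr⟩
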